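/- Let $F_1$ and $F_2$ be non-abelian free groups (of arbitrary, possibly infinite, rank). A subgroup $G\le F_1\times F_2$ is called a subdirect product of $F_1$ and $F_2$ if it projects surjectively onto each of the two factors. Then there is a set $\mathcal G$ of subdirect products $G\le F_1\times F_2$, of cardinality $2^{\aleph_0}$, such that for any two distinct $G,H\in\mathcal G$ the first homology groups $H_1(G,\mathbb Z)$ and $H_1(H,\mathbb Z)$ (with coefficients in the trivial module $\mathbb Z$) are not isomorphic as abelian groups. -/

import Mathlib

open scoped Cardinal

universe u

/-- A subgroup `G ≤ A × B` is a subdirect product of `A` and `B` if it projects surjectively to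
each of the two factors. -/
def IsSubdirectProduct {A B : Type*} [Group A] [Group B] (G : Subgroup (A × B)) : Prop :=
  G.map (MonoidHom.fst A B) = ⊤ ∧ G.map (MonoidHom.snd A B) = ⊤

/-- The first homology group `H₁(G, ℤ)` of a group `G` with coefficients in the trivial module `ℤ`.
Mathlib's group homology wants the coefficient ring in the universe of `G`, hence the `ULift`,
which is only a copy of the ring `ℤ` in that universe. -/
noncomputable abbrev integralH1 (G : Type u) [Group G] : Type u :=
  groupHomology.H1 (Rep.trivial (ULift.{u} ℤ) G (ULift.{u} ℤ))

open scoped commutatorElement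

/-- First homology with trivial integral coefficients is the abelianization. -/
noncomputable def integralH1EquivAbelianization (G : Type u) [Group G] :
    integralH1 G ≃+ Additive (Abelianization G) :=
  (groupHomology.H1AddEquivOfIsTrivial _).trans <|
    ((TensorProduct.congr (LinearEquiv.refl ℤ _)
      (AddEquiv.ulift (α := ℤ)).toIntLinearEquiv).trans
        (TensorProduct.rid ℤ (Additive (Abelianization G)))).toAddEquiv

theorem commutatorElement_mul_left_of_mem_center {H : Type*} [Group H] {c : H}
    (hc : c ∈ Subgroup.center H) (a b : H) : ⁅c * a, b⁆ = ⁅a, b⁆ := by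
  rw [commutatorElement_mul_left_eq_conj_mul,
    commutatorElement_eq_one_iff_mul_comm.2 (Subgroup.mem_center_iff.1 hc b).symm, mul_one,
    ← Subgroup.mem_center_iff.1 hc, mul_inv_cancel_right]

theorem commutatorElement_mul_right_of_mem_center {H : Type*} [Group H] {c : H}
    (hc : c ∈ Subgroup.center H) (a b : H) : ⁅a, c * b⁆ = ⁅a, b⁆ := by
  rw [← commutatorElement_inv, commutatorElement_mul_left_of_mem_center hc, commutatorElement_inv]

/-- Two homomorphisms differing by central elements agree on the commutator subgroup. -/
theorem MonoidHom.eq_of_mem_commutator_of_mul_inv_mem_center {G H : Type*} [Group G] [Group H]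
    (α β : G →* H) (h : ∀ g, α g * (β g)⁻¹ ∈ Subgroup.center H) {g : G}
    (hg : g ∈ commutator G) : α g = β g := by
  suffices commutator G ≤ α.eqLocus β from this hg
  rw [commutator_def, Subgroup.commutator_le]
  rintro x - y -
  change α ⁅x, y⁆ = β ⁅x, y⁆
  have hx : α x = (α x * (β x)⁻¹) * β x := by simp
  have hy : α y = (α y * (β y)⁻¹) * β y := by simp
  rw [map_commutatorElement, map_commutatorElement, hx, hy,
    commutatorElement_mul_left_of_mem_center (h x), commutatorElement_mul_right_of_mem_center (h y)]

section CommutatorTop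

variable {G : Type*} [Group G] (N : Subgroup G) [N.Normal]

/-- The image of `N` is central in the quotient by `⁅⊤, N⁆`. -/
theorem QuotientGroup.mk_mem_center_of_mem {n : G} (hn : n ∈ N) :
    (n : G ⧸ ⁅(⊤ : Subgroup G), N⁆) ∈ Subgroup.center (G ⧸ ⁅(⊤ : Subgroup G), N⁆) := by
  rw [Subgroup.mem_center_iff]
  intro g
  induction g using QuotientGroup.induction_on with
  | H g =>
    rw [← commutatorElement_eq_one_iff_mul_comm]
    change ((⁅g, n⁆ : G) : G ⧸ ⁅(⊤ : Subgroup G), N⁆) = 1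
    rw [QuotientGroup.eq_one_iff]
    exact Subgroup.commutator_mem_commutator trivial hn

end CommutatorTop

section FibreProduct

variable {F F₁ F₂ : Type*} [Group F] [Group F₁] [Group F₂]

theorem map_commutator_top_le {π₁ : F₁ →* F} {σ₁ : F →* F₁} (N : Subgroup F)
    (h₁ : ∀ x, π₁ (σ₁ x) = x) :
    ⁅(⊤ : Subgroup F), N⁆ ≤ ⁅(⊤ : Subgroup F₁), N.comap π₁⁆.comap σ₁ := by
  rw [Subgroup.commutator_le]
  intro f _ n hn
  rw [Subgroup.mem_comap, map_commutatorElement]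
  exact Subgroup.commutator_mem_commutator trivial (by simpa [h₁] using hn)

/-- The fibre product of `F₁` and `F₂` over the quotient `F ⧸ N`. -/
def fibreProduct (π₁ : F₁ →* F) (π₂ : F₂ →* F) (N : Subgroup F) [N.Normal] :
    Subgroup (F₁ × F₂) :=
  (((QuotientGroup.mk' N).comp π₁).comp (MonoidHom.fst F₁ F₂)).eqLocus
    (((QuotientGroup.mk' N).comp π₂).comp (MonoidHom.snd F₁ F₂))

variable (π₁ : F₁ →* F) (π₂ : F₂ →* F) (N : Subgroup F) [N.Normal]

theorem mem_fibreProduct {x : F₁ × F₂} :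
    x ∈ fibreProduct π₁ π₂ N ↔ π₁ x.1 * (π₂ x.2)⁻¹ ∈ N := by
  change (π₁ x.1 : F ⧸ N) = (π₂ x.2 : F ⧸ N) ↔ _
  rw [← QuotientGroup.eq_one_iff, QuotientGroup.mk_mul, QuotientGroup.mk_inv, mul_inv_eq_one]

variable {π₁ π₂} {σ₁ : F →* F₁} {σ₂ : F →* F₂}

theorem isSubdirectProduct_fibreProduct (h₁ : ∀ x, π₁ (σ₁ x) = x) (h₂ : ∀ x, π₂ (σ₂ x) = x) :
    IsSubdirectProduct (fibreProduct π₁ π₂ N) := by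
  constructor
  · refine eq_top_iff.2 fun u _ => ⟨(u, σ₂ (π₁ u)), ?_, rfl⟩
    exact (mem_fibreProduct _ _ _).2 (by simp [h₂])
  · refine eq_top_iff.2 fun v _ => ⟨(σ₁ (π₂ v), v), ?_, rfl⟩
    exact (mem_fibreProduct _ _ _).2 (by simp [h₁])

theorem mem_commutator_fibreProduct_of_mem (h₂ : ∀ x, π₂ (σ₂ x) = x) {w : F₁}
    (hw : w ∈ ⁅(⊤ : Subgroup F₁), N.comap π₁⁆) :
    (w, (1 : F₂)) ∈ ⁅fibreProduct π₁ π₂ N, fibreProduct π₁ π₂ N⁆ := by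
  suffices ⁅(⊤ : Subgroup F₁), N.comap π₁⁆ ≤
      ⁅fibreProduct π₁ π₂ N, fibreProduct π₁ π₂ N⁆.comap (MonoidHom.inl F₁ F₂) from this hw
  rw [Subgroup.commutator_le]
  intro f _ z hz
  have : MonoidHom.inl F₁ F₂ ⁅f, z⁆ = ⁅((f, σ₂ (π₁ f)) : F₁ × F₂), (z, 1)⁆ := by
    simp [commutatorElement_def]
  rw [Subgroup.mem_comap, this]
  refine Subgroup.commutator_mem_commutator ?_ ?_
  · exact (mem_fibreProduct _ _ _).2 (by simp [h₂])
  · exact (mem_fibreProduct _ _ _).2 (by simpa using hz)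

theorem mem_commutator_top_of_mem_commutator_fibreProduct {x : F₁ × F₂}
    (hx : x ∈ ⁅fibreProduct π₁ π₂ N, fibreProduct π₁ π₂ N⁆) :
    π₁ x.1 * (π₂ x.2)⁻¹ ∈ ⁅(⊤ : Subgroup F), N⁆ := by
  rw [← Subgroup.map_subtype_commutator] at hx
  obtain ⟨g, hg, rfl⟩ := hx
  have := MonoidHom.eq_of_mem_commutator_of_mul_inv_mem_center
    ((((QuotientGroup.mk' ⁅(⊤ : Subgroup F), N⁆).comp π₁).comp (MonoidHom.fst F₁ F₂)).comp
      (fibreProduct π₁ π₂ N).subtype)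
    ((((QuotientGroup.mk' ⁅(⊤ : Subgroup F), N⁆).comp π₂).comp (MonoidHom.snd F₁ F₂)).comp
      (fibreProduct π₁ π₂ N).subtype)
    (fun g => QuotientGroup.mk_mem_center_of_mem N ((mem_fibreProduct _ _ _).1 g.2)) hg
  rw [← QuotientGroup.eq_one_iff, QuotientGroup.mk_mul, QuotientGroup.mk_inv, mul_inv_eq_one]
  exact this

/-- Over a retract, an element of the commutator subgroup whose image lies in `⁅⊤, N⁆` lies in
the commutator of `⊤` with the preimage of `N`. -/
theorem mem_commutator_top_comap (h₁ : ∀ x, π₁ (σ₁ x) = x) {w : F₁} (hw : w ∈ commutator F₁)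
    (hn : π₁ w ∈ ⁅(⊤ : Subgroup F), N⁆) : w ∈ ⁅(⊤ : Subgroup F₁), N.comap π₁⁆ := by
  have := MonoidHom.eq_of_mem_commutator_of_mul_inv_mem_center
    (QuotientGroup.mk' ⁅(⊤ : Subgroup F₁), N.comap π₁⁆)
    ((QuotientGroup.mk' ⁅(⊤ : Subgroup F₁), N.comap π₁⁆).comp (σ₁.comp π₁))
    (fun g => QuotientGroup.mk_mem_center_of_mem (n := g * (σ₁ (π₁ g))⁻¹) (N.comap π₁)
      (by simp [h₁, N.one_mem])) hw
  rw [← QuotientGroup.eq_one_iff]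
  refine this.trans ((QuotientGroup.eq_one_iff _).2 ?_)
  exact map_commutator_top_le N h₁ hn

/-- The abelianization of a fibre product of `F₁` and `F₂` over `F ⧸ N`, where `F` is a retract of
both factors, has the same `p`-torsion as `N ⧸ ⁅F, N⁆`, provided that the abelianizations of the
factors have none. -/
theorem exists_torsion_abelianization_fibreProduct_iff
    (h₁ : ∀ x, π₁ (σ₁ x) = x) (h₂ : ∀ x, π₂ (σ₂ x) = x) (p : ℕ)
    (t₁ : ∀ x : F₁, x ^ p ∈ commutator F₁ → x ∈ commutator F₁)
    (t₂ : ∀ x : F₂, x ^ p ∈ commutator F₂ → x ∈ commutator F₂) :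
    (∃ x : Abelianization (fibreProduct π₁ π₂ N), x ≠ 1 ∧ x ^ p = 1) ↔
      ∃ n ∈ N, n ∉ ⁅(⊤ : Subgroup F), N⁆ ∧ n ^ p ∈ ⁅(⊤ : Subgroup F), N⁆ := by
  set G := fibreProduct π₁ π₂ N with hG
  have key (g : G) : Abelianization.of g = 1 ↔ (g : F₁ × F₂) ∈ ⁅G, G⁆ := by
    rw [← MonoidHom.mem_ker, Abelianization.ker_of, ← Subgroup.map_subtype_commutator]
    exact (Subgroup.mem_map_iff_mem G.subtype_injective).symm
  constructor
  · rintro ⟨x, hx, hxp⟩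
    obtain ⟨g, rfl⟩ := QuotientGroup.mk_surjective x
    change Abelianization.of g ≠ 1 at hx
    change Abelianization.of g ^ p = 1 at hxp
    rw [← map_pow, key] at hxp
    rw [Ne, key] at hx
    obtain ⟨⟨u, v⟩, hg⟩ := g
    have hprod : ⁅G, G⁆ ≤ (commutator F₁).prod (commutator F₂) := by
      rw [commutator_def, commutator_def, ← Subgroup.commutator_prod_prod]
      exact Subgroup.commutator_mono (by simp) (by simp)
    have hu : u ∈ commutator F₁ := t₁ u (hprod hxp).1
    have hv : v ∈ commutator F₂ := t₂ v (hprod hxp).2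
    have hN := (mem_fibreProduct _ _ _).1 hg
    refine ⟨π₁ u * (π₂ v)⁻¹, hN, fun hn => hx ?_, ?_⟩
    · have e : ((u, v) : F₁ × F₂) = (u * (σ₁ (π₂ v))⁻¹, 1) * (σ₁ (π₂ v), v) := by simp
      change ((u, v) : F₁ × F₂) ∈ _
      rw [e]
      refine mul_mem (mem_commutator_fibreProduct_of_mem N h₂
        (mem_commutator_top_comap N h₁ (mul_mem hu (inv_mem ?_)) (by simpa [h₁] using hn))) ?_
      · have := Subgroup.mem_map_of_mem (σ₁.comp π₂) hv
        rw [commutator_def, Subgroup.map_commutator] at this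
        rw [commutator_def]
        exact Subgroup.commutator_mono le_top le_top this
      · have := Subgroup.mem_map_of_mem ((σ₁.comp π₂).prod (MonoidHom.id F₂)) hv
        rw [commutator_def, Subgroup.map_commutator] at this
        refine Subgroup.commutator_mono ?_ ?_ this <;>
        · rintro _ ⟨y, -, rfl⟩
          exact (mem_fibreProduct _ _ _).2 (by simp [h₁])
    · have hp := mem_commutator_top_of_mem_commutator_fibreProduct N hxp
      have hc := QuotientGroup.mk_mem_center_of_mem N hN
      change π₁ (u ^ p) * (π₂ (v ^ p))⁻¹ ∈ _ at hp
      rw [← QuotientGroup.eq_one_iff, QuotientGroup.mk_mul, QuotientGroup.mk_inv, map_pow, map_pow,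
        QuotientGroup.mk_pow, QuotientGroup.mk_pow, mul_inv_eq_one] at hp
      rw [← QuotientGroup.eq_one_iff, QuotientGroup.mk_pow]
      have hcomm : Commute ((π₁ u * (π₂ v)⁻¹ : F) : F ⧸ ⁅(⊤ : Subgroup F), N⁆) (π₂ v : F) :=
        (Subgroup.mem_center_iff.1 hc _).symm
      have := hcomm.mul_pow p
      rwa [← QuotientGroup.mk_mul, inv_mul_cancel_right, hp, right_eq_mul] at this
  · rintro ⟨n, hn, hn', hnp⟩
    have hg : ((σ₁ n, 1) : F₁ × F₂) ∈ G := (mem_fibreProduct _ _ _).2 (by simpa [h₁] using hn)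
    refine ⟨Abelianization.of ⟨_, hg⟩, ?_, ?_⟩
    · rw [Ne, key]
      intro h
      have := mem_commutator_top_of_mem_commutator_fibreProduct N h
      simp [h₁] at this
      exact hn' this
    · rw [← map_pow, key]
      have := mem_commutator_fibreProduct_of_mem (π₂ := π₂) N h₂ (map_commutator_top_le N h₁ hnp)
      simpa using this

end FibreProduct

section Free

/-- The exponent sums of an element of a free group. -/
noncomputable def FreeGroup.exponentSum (X : Type*) : FreeGroup X →* Multiplicative (X →₀ ℤ) :=
  FreeGroup.lift fun i => Multiplicative.ofAdd (Finsupp.single i 1)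

theorem FreeGroup.mem_commutator_iff {X : Type*} {x : FreeGroup X} :
    x ∈ commutator (FreeGroup X) ↔ FreeGroup.exponentSum X x = 1 := by
  have h : FreeAbelianGroup.equivFinsupp X (Additive.ofMul (Abelianization.of x)) =
      Multiplicative.toAdd (FreeGroup.exponentSum X x) := rfl
  rw [← Abelianization.ker_of, MonoidHom.mem_ker, ← toAdd_eq_zero, ← h]
  exact (map_eq_zero_iff _ (FreeAbelianGroup.equivFinsupp X).injective).symm

theorem IsFreeGroup.mem_commutator_of_pow_mem {G : Type*} [Group G] [IsFreeGroup G] {p : ℕ}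
    (hp : p ≠ 0) {x : G} (hx : x ^ p ∈ commutator G) : x ∈ commutator G := by
  have h (y : G) : IsFreeGroup.toFreeGroup G y ∈ commutator _ ↔ y ∈ commutator G := by
    have : (commutator G).map (IsFreeGroup.toFreeGroup G).toMonoidHom = commutator _ := by
      rw [commutator_def, Subgroup.map_commutator,
        Subgroup.map_top_of_surjective _ (IsFreeGroup.toFreeGroup G).surjective, commutator_def]
    rw [← this]
    exact Subgroup.mem_map_iff_mem (IsFreeGroup.toFreeGroup G).injective
  rw [← h, FreeGroup.mem_commutator_iff] at hx ⊢
  rw [map_pow, map_pow] at hx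
  have : p • Multiplicative.toAdd (FreeGroup.exponentSum _ (IsFreeGroup.toFreeGroup G x)) = 0 := hx
  exact (smul_eq_zero.1 this).resolve_left hp

theorem IsFreeGroup.exists_generators_ne {G : Type*} [Group G] [IsFreeGroup G]
    (h : ¬ IsMulCommutative G) : ∃ a b : IsFreeGroup.Generators G, a ≠ b := by
  by_contra! H
  have h1 (a : IsFreeGroup.Generators G) (g : G) :
      IsFreeGroup.of a * g * (IsFreeGroup.of a)⁻¹ = g := by
    have : (MulAut.conj (IsFreeGroup.of a)).toMonoidHom = MonoidHom.id G :=
      IsFreeGroup.ext_hom fun b => by simp [H b a]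
    exact DFunLike.congr_fun this g
  refine h ⟨⟨fun g k => ?_⟩⟩
  have : (MulAut.conj g).toMonoidHom = MonoidHom.id G :=
    IsFreeGroup.ext_hom fun b => by
      have := h1 b g
      rw [mul_inv_eq_iff_eq_mul] at this
      simp [← this]
  have := DFunLike.congr_fun this k
  exact mul_inv_eq_iff_eq_mul.1 this

/-- A non-abelian free group retracts onto a free group of rank two. -/
theorem IsFreeGroup.exists_retraction {G : Type*} [Group G] [IsFreeGroup G]
    (h : ¬ IsMulCommutative G) :
    ∃ (π : G →* FreeGroup Bool) (σ : FreeGroup Bool →* G), ∀ x, π (σ x) = x := by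
  classical
  obtain ⟨a, b, hab⟩ := IsFreeGroup.exists_generators_ne h
  refine ⟨IsFreeGroup.lift fun i => if i = a then FreeGroup.of true else FreeGroup.of false,
    FreeGroup.lift fun i => IsFreeGroup.of (if i then a else b), fun x => ?_⟩
  set π : G →* FreeGroup Bool := IsFreeGroup.lift _ with hπ
  set σ : FreeGroup Bool →* G := FreeGroup.lift _ with hσ
  have : π.comp σ = MonoidHom.id _ := FreeGroup.ext_hom _ _ fun i => by
    cases i <;> simp [hπ, hσ, IsFreeGroup.lift_of, hab.symm]
  exact DFunLike.congr_fun this x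

end Free

section UnitriangularRepresentation

open Matrix LaurentPolynomial DualNumber

/-- Dual numbers over the integral Laurent polynomials. -/
abbrev LaurentDual : Type := DualNumber ℤ[T;T⁻¹]

namespace LaurentDual

/-- The indeterminate of the Laurent polynomial ring, as a unit of the dual numbers. -/
noncomputable def unitT : LaurentDualˣ where
  val := algebraMap ℤ[T;T⁻¹] LaurentDual (T 1)
  inv := algebraMap ℤ[T;T⁻¹] LaurentDual (T (-1))
  val_inv := by rw [← map_mul, ← T_add]; simp
  inv_val := by rw [← map_mul, ← T_add]; simp

/-- The unit `1 + ε`. -/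
noncomputable def unitEps : LaurentDualˣ where
  val := 1 + ε
  inv := 1 - ε
  val_inv := by linear_combination -(DualNumber.eps_mul_eps : (ε * ε : LaurentDual) = 0)
  inv_val := by linear_combination -(DualNumber.eps_mul_eps : (ε * ε : LaurentDual) = 0)

/-- The coefficient of `T ^ i`. -/
noncomputable def coeffFst (i : ℤ) : LaurentDual →+ ℤ where
  toFun c := (TrivSqZeroExt.fst c).coeff i
  map_zero' := by simp
  map_add' _ _ := by simp

/-- The coefficient of `ε * T ^ i`. -/
noncomputable def coeffSnd (i : ℤ) : LaurentDual →+ ℤ where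
  toFun c := (TrivSqZeroExt.snd c).coeff i
  map_zero' := by simp
  map_add' _ _ := by simp

theorem coeffFst_eps_mul (i : ℤ) (c : LaurentDual) : coeffFst i (ε * c) = 0 := by
  change (TrivSqZeroExt.fst (ε * c)).coeff i = 0
  simp

theorem coeffSnd_eps_mul (i : ℤ) (c : LaurentDual) : coeffSnd i (ε * c) = coeffFst i c := by
  change (TrivSqZeroExt.snd (ε * c)).coeff i = (TrivSqZeroExt.fst c).coeff i
  simp

/-- The upper right entry of the image of the `k`-th distinguished word. -/
noncomputable def wordEntry (k : ℕ) : LaurentDual :=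
  ((unitT ^ k * (unitEps⁻¹) ^ k : LaurentDualˣ) : LaurentDual) - ((unitT⁻¹ ^ k : LaurentDualˣ))

theorem coeffFst_wordEntry (p q : Nat.Primes) :
    coeffFst (p : ℕ) (wordEntry q) = Finsupp.single q 1 p := by
  have h1 : TrivSqZeroExt.fst (wordEntry q) = T (q : ℕ) - T (-(q : ℕ)) := by
    simp [wordEntry, unitT, unitEps, TrivSqZeroExt.algebraMap_eq_inl, T_pow]
  have := p.2.pos
  change (TrivSqZeroExt.fst (wordEntry q)).coeff _ = _
  rw [h1]
  simp only [LaurentPolynomial.T, AddMonoidAlgebra.coeff_sub, AddMonoidAlgebra.coeff_single,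
    Finsupp.sub_apply, Finsupp.single_apply]
  have h2 : (-((q : ℕ) : ℤ) = ((p : ℕ) : ℤ)) ↔ False := by
    simp only [iff_false]
    omega
  have h3 : (((q : ℕ) : ℤ) = ((p : ℕ) : ℤ)) ↔ q = p := by
    rw [Nat.cast_inj]
    exact Subtype.ext_iff.symm
  simp [h2, h3]

end LaurentDual

open LaurentDual

/-- Invertible matrices of size three over the dual numbers. -/
abbrev LaurentGL : Type := (Matrix (Fin 3) (Fin 3) LaurentDual)ˣ

namespace LaurentGL

/-- The diagonal matrix with entries `1`, `x`, `y`. -/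
noncomputable def diag : LaurentDualˣ × LaurentDualˣ →* LaurentGL where
  toFun x :=
    { val := !![1, 0, 0; 0, x.1, 0; 0, 0, x.2]
      inv := !![1, 0, 0; 0, (x.1⁻¹ : LaurentDualˣ), 0; 0, 0, (x.2⁻¹ : LaurentDualˣ)]
      val_inv := by simp [Matrix.one_fin_three]
      inv_val := by simp [Matrix.one_fin_three] }
  map_one' := by ext1; simp [Matrix.one_fin_three]
  map_mul' x y := by ext1; simp

/-- The elementary matrices supported in the upper right corner. -/
noncomputable def corner : Multiplicative LaurentDual →* LaurentGL where
  toFun c :=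
    { val := !![1, 0, c.toAdd; 0, 1, 0; 0, 0, 1]
      inv := !![1, 0, -c.toAdd; 0, 1, 0; 0, 0, 1]
      val_inv := by simp [Matrix.one_fin_three]
      inv_val := by simp [Matrix.one_fin_three] }
  map_one' := by ext1; simp [Matrix.one_fin_three]
  map_mul' x y := by ext1; simp [add_comm]

theorem corner_injective : Function.Injective corner := fun x y h => by
  have := congrArg (fun M : LaurentGL => M.val 0 2) h
  simpa [corner] using this

/-- The unipotent Jordan block. -/
noncomputable def jordan : LaurentGL where
  val := !![1, 1, 0; 0, 1, 1; 0, 0, 1]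
  inv := !![1, -1, 1; 0, 1, -1; 0, 0, 1]
  val_inv := by simp [Matrix.one_fin_three]
  inv_val := by simp [Matrix.one_fin_three]

theorem commutator_jordan_conj_diag (x y : LaurentDualˣ) :
    ⁅jordan, diag (x, y) * jordan * (diag (x, y))⁻¹⁆ =
      corner (Multiplicative.ofAdd
        (((x * y⁻¹ : LaurentDualˣ) : LaurentDual) - (x⁻¹ : LaurentDualˣ))) := by
  rw [commutatorElement_def, mul_inv_eq_iff_eq_mul, mul_inv_eq_iff_eq_mul, ← map_inv]
  ext i j : 2
  fin_cases i <;> fin_cases j <;>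
    simp [diag, jordan, corner, Matrix.mul_apply, Fin.sum_univ_succ, add_comm]

theorem diag_conj_corner (x y : LaurentDualˣ) (c : LaurentDual) :
    diag (x, y) * corner (Multiplicative.ofAdd c) * (diag (x, y))⁻¹ =
      corner (Multiplicative.ofAdd (c * (y⁻¹ : LaurentDualˣ))) := by
  rw [mul_inv_eq_iff_eq_mul]
  ext i j : 2
  fin_cases i <;> fin_cases j <;>
    simp [diag, corner, Matrix.mul_apply, Fin.sum_univ_succ]

theorem jordan_conj_corner (c : LaurentDual) :
    jordan * corner (Multiplicative.ofAdd c) * jordan⁻¹ = corner (Multiplicative.ofAdd c) := by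
  rw [mul_inv_eq_iff_eq_mul]
  ext i j : 2
  fin_cases i <;> fin_cases j <;>
    simp [jordan, corner, Matrix.mul_apply, Fin.sum_univ_succ]

end LaurentGL

open LaurentGL

/-- The representation of the free group of rank two. -/
noncomputable def freeRep : FreeGroup Bool →* LaurentGL :=
  FreeGroup.lift fun i => if i then diag (unitT, unitEps) else jordan

/-- The distinguished words in the free group of rank two. -/
def freeWord (k : ℕ) : FreeGroup Bool :=
  ⁅FreeGroup.of false, FreeGroup.of true ^ k * FreeGroup.of false * (FreeGroup.of true ^ k)⁻¹⁆

theorem freeRep_freeWord (k : ℕ) :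
    freeRep (freeWord k) = corner (Multiplicative.ofAdd (wordEntry k)) := by
  have := commutator_jordan_conj_diag (unitT ^ k) (unitEps ^ k)
  rw [← Prod.pow_mk, map_pow] at this
  simpa [freeRep, freeWord, map_commutatorElement, wordEntry] using this

theorem freeRep_true_conj_corner (c : LaurentDual) :
    freeRep (FreeGroup.of true) * corner (Multiplicative.ofAdd c) *
      (freeRep (FreeGroup.of true))⁻¹ = corner (Multiplicative.ofAdd (c + -(ε * c))) := by
  have h : c * ((unitEps⁻¹ : LaurentDualˣ) : LaurentDual) = c + -(ε * c) := by
    change c * (1 - ε) = _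
    ring
  rw [← h, ← diag_conj_corner unitT]
  simp [freeRep]

theorem exists_freeRep_conj_corner (f : FreeGroup Bool) : ∃ m : ℤ, ∀ c : LaurentDual,
    freeRep f * corner (Multiplicative.ofAdd c) * (freeRep f)⁻¹ =
      corner (Multiplicative.ofAdd (c + m • (ε * c))) := by
  induction f using FreeGroup.induction_on with
  | C1 => exact ⟨0, by simp⟩
  | of i =>
    cases i with
    | false => exact ⟨0, fun c => by simpa [freeRep] using jordan_conj_corner c⟩
    | true => exact ⟨-1, fun c => by rw [neg_one_zsmul, ← freeRep_true_conj_corner]⟩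
  | inv_of i h =>
    obtain ⟨m, h⟩ := h
    refine ⟨-m, fun c => ?_⟩
    have := h (c + (-m) • (ε * c))
    have e : c + (-m) • (ε * c) + m • (ε * (c + (-m) • (ε * c))) = c := by
      simp only [zsmul_eq_mul]
      push_cast
      linear_combination (-m * m * c) * (DualNumber.eps_mul_eps : (ε * ε : LaurentDual) = 0)
    rw [e] at this
    rw [map_inv, ← this]
    group
  | mul f g hf hg =>
    obtain ⟨m, hf⟩ := hf
    obtain ⟨n, hg⟩ := hg
    refine ⟨m + n, fun c => ?_⟩
    have e : c + n • (ε * c) + m • (ε * (c + n • (ε * c))) = c + (m + n) • (ε * c) := by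
      simp only [zsmul_eq_mul]
      push_cast
      linear_combination (m * n * c) * (DualNumber.eps_mul_eps : (ε * ε : LaurentDual) = 0)
    rw [← e, ← hf, ← hg, map_mul]
    group

/-- The words represented by corner matrices with entry in `J`. -/
noncomputable def cornerSubgroup (J : AddSubgroup LaurentDual) : Subgroup (FreeGroup Bool) :=
  (J.toSubgroup.map corner).comap freeRep

theorem mem_cornerSubgroup {J : AddSubgroup LaurentDual} {w : FreeGroup Bool} :
    w ∈ cornerSubgroup J ↔ ∃ c ∈ J, corner (Multiplicative.ofAdd c) = freeRep w :=
  Iff.rfl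

theorem commutator_cornerSubgroup_le {I J : AddSubgroup LaurentDual} (h : ∀ c ∈ I, ε * c ∈ J) :
    ⁅(⊤ : Subgroup (FreeGroup Bool)), cornerSubgroup I⁆ ≤ cornerSubgroup J := by
  rw [Subgroup.commutator_le]
  rintro f - w hw
  obtain ⟨c, hc, hw⟩ := mem_cornerSubgroup.1 hw
  obtain ⟨m, hm⟩ := exists_freeRep_conj_corner f
  refine mem_cornerSubgroup.2 ⟨m • (ε * c), J.zsmul_mem (h c hc) m, ?_⟩
  rw [map_commutatorElement, commutatorElement_def, ← hw, hm, ← map_inv, ← map_mul]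
  congr 1
  rw [← ofAdd_neg, ← ofAdd_add]
  simp

end UnitriangularRepresentation

section Relators

open LaurentDual LaurentGL DualNumber

/-- The normal closure of the distinguished words with prime index. -/
def wordClosure : Subgroup (FreeGroup Bool) :=
  Subgroup.normalClosure (Set.range fun q : Nat.Primes => freeWord q)

instance : wordClosure.Normal := Subgroup.normalClosure_normal

/-- The exponent of the `q`-th word. -/
noncomputable def relatorExponent (S : Set Nat.Primes) (q : Nat.Primes) : ℕ :=
  open Classical in if q ∈ S then q else 1

/-- The subgroup generated by the commutators of the distinguished words and by powers of these
words. -/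
noncomputable def relatorSubgroup (S : Set Nat.Primes) : Subgroup (FreeGroup Bool) :=
  ⁅(⊤ : Subgroup (FreeGroup Bool)), wordClosure⁆ ⊔
    Subgroup.closure (Set.range fun q : Nat.Primes => freeWord q ^ relatorExponent S q)

theorem freeWord_mem_wordClosure (q : Nat.Primes) : freeWord q ∈ wordClosure :=
  Subgroup.subset_normalClosure ⟨q, rfl⟩

theorem commutator_le_relatorSubgroup (S : Set Nat.Primes) :
    ⁅(⊤ : Subgroup (FreeGroup Bool)), wordClosure⁆ ≤ relatorSubgroup S :=
  le_sup_left

theorem relatorSubgroup_le_wordClosure (S : Set Nat.Primes) :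
    relatorSubgroup S ≤ wordClosure := by
  refine sup_le (Subgroup.commutator_le_right _ _) ((Subgroup.closure_le _).2 ?_)
  rintro _ ⟨q, rfl⟩
  exact pow_mem (freeWord_mem_wordClosure q) _

instance (S : Set Nat.Primes) : (relatorSubgroup S).Normal :=
  Subgroup.commutator_top_left_le_iff.1 <|
    (Subgroup.commutator_mono le_rfl (relatorSubgroup_le_wordClosure S)).trans
      (commutator_le_relatorSubgroup S)

theorem freeWord_pow_mem_relatorSubgroup (S : Set Nat.Primes) (q : Nat.Primes) :
    freeWord q ^ relatorExponent S q ∈ relatorSubgroup S :=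
  le_sup_right (a := ⁅(⊤ : Subgroup (FreeGroup Bool)), wordClosure⁆)
    (Subgroup.subset_closure ⟨q, rfl⟩)

theorem wordClosure_le_cornerSubgroup : wordClosure ≤ cornerSubgroup ⊤ := by
  have : (cornerSubgroup ⊤).Normal := Subgroup.commutator_top_left_le_iff.1 <|
    commutator_cornerSubgroup_le fun _ _ => trivial
  refine Subgroup.normalClosure_le_normal ?_
  rintro _ ⟨q, rfl⟩
  exact mem_cornerSubgroup.2 ⟨_, trivial, (freeRep_freeWord q).symm⟩

theorem commutator_wordClosure_le_cornerSubgroup (q : Nat.Primes) :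
    ⁅(⊤ : Subgroup (FreeGroup Bool)), wordClosure⁆ ≤ cornerSubgroup (coeffFst (q : ℕ)).ker :=
  (Subgroup.commutator_mono le_rfl wordClosure_le_cornerSubgroup).trans <|
    commutator_cornerSubgroup_le fun c _ => coeffFst_eps_mul _ c

theorem relatorSubgroup_le_cornerSubgroup {S : Set Nat.Primes} {p : Nat.Primes} (hp : p ∈ S) :
    relatorSubgroup S ≤
      cornerSubgroup ((AddSubgroup.zmultiples ((p : ℕ) : ℤ)).comap (coeffFst (p : ℕ))) := by
  refine sup_le ((commutator_wordClosure_le_cornerSubgroup p).trans ?_)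
    ((Subgroup.closure_le _).2 ?_)
  · refine Subgroup.comap_mono (Subgroup.map_mono fun c hc => ?_)
    change coeffFst (p : ℕ) _ = 0 at hc
    change coeffFst (p : ℕ) _ ∈ AddSubgroup.zmultiples _
    rw [hc]
    exact zero_mem _
  · rintro _ ⟨q, rfl⟩
    refine mem_cornerSubgroup.2 ⟨relatorExponent S q • wordEntry q, ?_, ?_⟩
    · rw [AddSubgroup.mem_comap, map_nsmul, coeffFst_wordEntry]
      by_cases h : q = p
      · subst h
        simp [relatorExponent, hp]
      · simp [h]
    · rw [ofAdd_nsmul, map_pow, map_pow, freeRep_freeWord]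

theorem commutator_relatorSubgroup_le_cornerSubgroup {S : Set Nat.Primes} {p : Nat.Primes}
    (hp : p ∈ S) : ⁅(⊤ : Subgroup (FreeGroup Bool)), relatorSubgroup S⁆ ≤
      cornerSubgroup ((AddSubgroup.zmultiples ((p : ℕ) : ℤ)).comap (coeffSnd (p : ℕ))) :=
  (Subgroup.commutator_mono le_rfl (relatorSubgroup_le_cornerSubgroup hp)).trans <|
    commutator_cornerSubgroup_le fun c hc => by
      rw [AddSubgroup.mem_comap, coeffSnd_eps_mul]
      exact hc

theorem commutatorElement_pow_of_mem_center {G : Type*} [Group G] {f r : G}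
    (h : ⁅f, r⁆ ∈ Subgroup.center G) (n : ℕ) : ⁅f, r ^ n⁆ = ⁅f, r⁆ ^ n := by
  have hc : Commute ⁅f, r⁆ r := (Subgroup.mem_center_iff.1 h r).symm
  have : f * r * f⁻¹ = ⁅f, r⁆ * r := by simp [commutatorElement_def]
  rw [commutatorElement_def, ← conj_pow, this, hc.mul_pow, mul_inv_cancel_right]

/-- Powers of commutators with distinguished words are trivial modulo the relators. -/
theorem commutator_freeWord_pow_mem (S : Set Nat.Primes) (q : Nat.Primes) (f : FreeGroup Bool) :
    ⁅f, freeWord q⁆ ^ relatorExponent S q ∈ ⁅(⊤ : Subgroup (FreeGroup Bool)), relatorSubgroup S⁆ := by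
  have hc := QuotientGroup.mk_mem_center_of_mem (relatorSubgroup S)
    (commutator_le_relatorSubgroup S
      (Subgroup.commutator_mem_commutator (Subgroup.mem_top f) (freeWord_mem_wordClosure q)))
  set L := ⁅(⊤ : Subgroup (FreeGroup Bool)), relatorSubgroup S⁆
  have h := commutatorElement_pow_of_mem_center (f := QuotientGroup.mk' L f)
    (r := QuotientGroup.mk' L (freeWord q)) (by rw [← map_commutatorElement]; exact hc)
    (relatorExponent S q)
  rw [← map_pow, ← map_commutatorElement, ← map_commutatorElement, ← map_pow] at h
  rw [← QuotientGroup.eq_one_iff]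
  refine Eq.trans h.symm ((QuotientGroup.eq_one_iff _).2 ?_)
  exact Subgroup.commutator_mem_commutator trivial (freeWord_pow_mem_relatorSubgroup S q)

theorem commutator_freeWord_not_mem {S : Set Nat.Primes} {p : Nat.Primes} (hp : p ∈ S) :
    ⁅FreeGroup.of true, freeWord p⁆ ∉ ⁅(⊤ : Subgroup (FreeGroup Bool)), relatorSubgroup S⁆ := by
  intro h
  obtain ⟨c, hc, h⟩ := mem_cornerSubgroup.1 (commutator_relatorSubgroup_le_cornerSubgroup hp h)
  rw [map_commutatorElement, freeRep_freeWord, commutatorElement_def, freeRep_true_conj_corner,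
    ← map_inv, ← map_mul, ← ofAdd_neg, ← ofAdd_add] at h
  have h := Multiplicative.ofAdd.injective (corner_injective h)
  rw [h, add_neg_cancel_comm, AddSubgroup.mem_comap, map_neg, coeffSnd_eps_mul,
    coeffFst_wordEntry, neg_mem_iff, Finsupp.single_eq_same, Int.mem_zmultiples_iff] at hc
  exact p.2.one_lt.ne' (by exact_mod_cast Int.eq_one_of_dvd_one (by positivity) hc)

/-- The subgroup of central elements of finite order, with an exponent coprime to `p`. -/
def centralCoprimeTorsion (Q : Type*) [Group Q] (p : ℕ) : Subgroup Q where
  carrier := {z | z ∈ Subgroup.center Q ∧ ∃ M : ℕ, M.Coprime p ∧ z ^ M = 1}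
  one_mem' := ⟨one_mem _, 1, by simp, by simp⟩
  mul_mem' := by
    rintro x y ⟨hx, M, hM, hxM⟩ ⟨hy, L, hL, hyL⟩
    have hc : Commute x y := Subgroup.mem_center_iff.1 hy x
    refine ⟨mul_mem hx hy, M * L, Nat.Coprime.mul_left hM hL, ?_⟩
    rw [hc.mul_pow, pow_mul, hxM, mul_comm, pow_mul, hyL, one_pow, one_pow, one_mul]
  inv_mem' := by
    rintro x ⟨hx, M, hM, hxM⟩
    exact ⟨inv_mem hx, M, hM, by rw [inv_pow, hxM, inv_one]⟩

instance (Q : Type*) [Group Q] (p : ℕ) : (centralCoprimeTorsion Q p).Normal where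
  conj_mem x hx g := by
    rwa [Subgroup.mem_center_iff.1 hx.1 g, mul_inv_cancel_right]

theorem exists_coprime_pow_mem {S : Set Nat.Primes} {p : Nat.Primes} (hp : p ∉ S)
    {k : FreeGroup Bool} (hk : k ∈ ⁅(⊤ : Subgroup (FreeGroup Bool)), wordClosure⁆) :
    ∃ M : ℕ, M.Coprime p ∧ k ^ M ∈ ⁅(⊤ : Subgroup (FreeGroup Bool)), relatorSubgroup S⁆ := by
  set L := ⁅(⊤ : Subgroup (FreeGroup Bool)), relatorSubgroup S⁆
  set W := (centralCoprimeTorsion (FreeGroup Bool ⧸ L) p).comap (QuotientGroup.mk' L) with hW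
  have h : wordClosure ≤ (Subgroup.center (FreeGroup Bool ⧸ W)).comap (QuotientGroup.mk' W) := by
    refine Subgroup.normalClosure_le_normal ?_
    rintro _ ⟨q, rfl⟩
    refine Subgroup.mem_center_iff.2 fun g => ?_
    obtain ⟨f, rfl⟩ := QuotientGroup.mk'_surjective W g
    rw [← commutatorElement_eq_one_iff_mul_comm, ← map_commutatorElement]
    refine (QuotientGroup.eq_one_iff _).2 ⟨?_, relatorExponent S q, ?_, ?_⟩
    · exact QuotientGroup.mk_mem_center_of_mem (relatorSubgroup S)
        (commutator_le_relatorSubgroup S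
          (Subgroup.commutator_mem_commutator (Subgroup.mem_top f) (freeWord_mem_wordClosure q)))
    · unfold relatorExponent
      split_ifs with hq
      · exact (Nat.coprime_primes q.2 p.2).2 fun h => hp (Subtype.ext h ▸ hq)
      · simp
    · rw [← map_pow]
      exact (QuotientGroup.eq_one_iff _).2 (commutator_freeWord_pow_mem S q f)
  have hKW : ⁅(⊤ : Subgroup (FreeGroup Bool)), wordClosure⁆ ≤ W := by
    rw [Subgroup.commutator_le]
    intro f _ n hn
    rw [← QuotientGroup.eq_one_iff]
    change QuotientGroup.mk' W _ = 1
    rw [map_commutatorElement, commutatorElement_eq_one_iff_mul_comm]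
    exact Subgroup.mem_center_iff.1 (h hn) _
  obtain ⟨-, M, hM, h⟩ := hKW hk
  rw [← map_pow] at h
  exact ⟨M, hM, (QuotientGroup.eq_one_iff _).1 h⟩

/-- The homomorphism from the free group on the primes given by the distinguished words. -/
def freeWordHom : FreeGroup Nat.Primes →* FreeGroup Bool :=
  FreeGroup.lift fun q => freeWord q

theorem range_freeWordHom_le : freeWordHom.range ≤ wordClosure := by
  rw [freeWordHom, FreeGroup.range_lift_eq_closure, Subgroup.closure_le]
  rintro _ ⟨q, rfl⟩
  exact freeWord_mem_wordClosure q

theorem wordClosure_le_sup :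
    wordClosure ≤ ⁅(⊤ : Subgroup (FreeGroup Bool)), wordClosure⁆ ⊔ freeWordHom.range := by
  have hle : ⁅(⊤ : Subgroup (FreeGroup Bool)), wordClosure⁆ ⊔ freeWordHom.range ≤ wordClosure :=
    sup_le (Subgroup.commutator_le_right _ _) range_freeWordHom_le
  have : (⁅(⊤ : Subgroup (FreeGroup Bool)), wordClosure⁆ ⊔ freeWordHom.range).Normal :=
    Subgroup.commutator_top_left_le_iff.1 <|
      (Subgroup.commutator_mono le_rfl hle).trans le_sup_left
  refine Subgroup.normalClosure_le_normal ?_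
  rintro _ ⟨q, rfl⟩
  exact le_sup_right (a := ⁅(⊤ : Subgroup (FreeGroup Bool)), wordClosure⁆)
    ⟨FreeGroup.of q, by simp [freeWordHom]⟩

theorem exists_freeRep_freeWordHom (x : FreeGroup Nat.Primes) :
    ∃ c : LaurentDual, freeRep (freeWordHom x) = corner (Multiplicative.ofAdd c) ∧
      ∀ q : Nat.Primes, coeffFst (q : ℕ) c = (FreeGroup.exponentSum _ x).toAdd q := by
  let γ : FreeGroup Nat.Primes →* Multiplicative LaurentDual :=
    FreeGroup.lift fun q => Multiplicative.ofAdd (wordEntry q)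
  refine ⟨(γ x).toAdd, ?_, fun q => ?_⟩
  · have : freeRep.comp freeWordHom = corner.comp γ :=
      FreeGroup.ext_hom _ _ fun q => by simp [γ, freeWordHom, freeRep_freeWord]
    exact DFunLike.congr_fun this x
  · have : (coeffFst (q : ℕ)).toMultiplicative.comp γ =
        (Finsupp.applyAddHom q).toMultiplicative.comp (FreeGroup.exponentSum Nat.Primes) :=
      FreeGroup.ext_hom _ _ fun r => by
        simp [γ, FreeGroup.exponentSum, coeffFst_wordEntry]
    exact congrArg Multiplicative.toAdd (DFunLike.congr_fun this x)

theorem mem_commutator_of_pow_mem {n : FreeGroup Bool} (hn : n ∈ wordClosure) {p : ℕ} (hp : p ≠ 0)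
    (h : n ^ p ∈ ⁅(⊤ : Subgroup (FreeGroup Bool)), wordClosure⁆) :
    n ∈ ⁅(⊤ : Subgroup (FreeGroup Bool)), wordClosure⁆ := by
  obtain ⟨k, hk, _, ⟨x, rfl⟩, rfl⟩ := Subgroup.mem_sup_of_normal_left.1 (wordClosure_le_sup hn)
  refine mul_mem hk ?_
  suffices hx : x ∈ commutator (FreeGroup Nat.Primes) by
    have := Subgroup.mem_map_of_mem freeWordHom hx
    rw [commutator_def, Subgroup.map_commutator] at this
    refine Subgroup.commutator_mono le_top ?_ this
    rintro _ ⟨y, -, rfl⟩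
    exact range_freeWordHom_le ⟨y, rfl⟩
  rw [FreeGroup.mem_commutator_iff, ← toAdd_eq_zero]
  obtain ⟨c, hc, hcq⟩ := exists_freeRep_freeWordHom x
  ext q
  obtain ⟨d, hd, hdk⟩ := mem_cornerSubgroup.1 (commutator_wordClosure_le_cornerSubgroup q hk)
  obtain ⟨e, he, hek⟩ := mem_cornerSubgroup.1 (commutator_wordClosure_le_cornerSubgroup q h)
  rw [map_pow, map_mul, hc, ← hdk, ← map_mul, ← map_pow, ← ofAdd_add, ← ofAdd_nsmul] at hek
  have := corner_injective hek
  rw [Multiplicative.ofAdd.apply_eq_iff_eq] at this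
  rw [AddMonoidHom.mem_ker] at hd he
  rw [this, map_nsmul, map_add, hd, zero_add, smul_eq_zero] at he
  rw [← hcq]
  exact he.resolve_left hp

theorem exists_torsion_relatorSubgroup_iff (S : Set Nat.Primes) (p : Nat.Primes) :
    (∃ n ∈ relatorSubgroup S, n ∉ ⁅(⊤ : Subgroup (FreeGroup Bool)), relatorSubgroup S⁆ ∧
      n ^ (p : ℕ) ∈ ⁅(⊤ : Subgroup (FreeGroup Bool)), relatorSubgroup S⁆) ↔ p ∈ S := by
  constructor
  · rintro ⟨n, hn, hn', hnp⟩
    by_contra hp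
    have hK := mem_commutator_of_pow_mem (relatorSubgroup_le_wordClosure S hn) p.2.ne_zero
      (Subgroup.commutator_mono le_rfl (relatorSubgroup_le_wordClosure S) hnp)
    obtain ⟨M, hM, h⟩ := exists_coprime_pow_mem hp hK
    apply hn'
    rw [← QuotientGroup.eq_one_iff] at h hnp ⊢
    rw [QuotientGroup.mk_pow] at h hnp
    have := pow_gcd_eq_one.2 ⟨h, hnp⟩
    rwa [Nat.Coprime.gcd_eq_one hM, pow_one] at this
  · intro hp
    refine ⟨_, commutator_le_relatorSubgroup S (Subgroup.commutator_mem_commutator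
      (Subgroup.mem_top (FreeGroup.of true)) (freeWord_mem_wordClosure p)),
      commutator_freeWord_not_mem hp, ?_⟩
    have := commutator_freeWord_pow_mem S p (FreeGroup.of true)
    rwa [relatorExponent, if_pos hp] at this

end Relators

section Main

theorem exists_torsion_integralH1_iff (G : Type u) [Group G] (p : ℕ) :
    (∃ x : integralH1 G, x ≠ 0 ∧ p • x = 0) ↔ ∃ x : Abelianization G, x ≠ 1 ∧ x ^ p = 1 := by
  let e := integralH1EquivAbelianization G
  constructor
  · rintro ⟨x, hx, hp⟩
    refine ⟨(e x).toMul, fun h => hx (e.map_eq_zero_iff.1 h), ?_⟩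
    have := congrArg e hp
    rw [map_nsmul, map_zero] at this
    exact this
  · rintro ⟨x, hx, hp⟩
    refine ⟨e.symm (Additive.ofMul x), fun h => hx (e.symm.map_eq_zero_iff.1 h), ?_⟩
    rw [← map_nsmul, ← ofMul_pow, hp, ofMul_one, map_zero]

end Main

theorem mainTheorem8 {F₁ F₂ : Type*} [Group F₁] [Group F₂] [IsFreeGroup F₁] [IsFreeGroup F₂]
    (h₁ : ¬ IsMulCommutative F₁) (h₂ : ¬ IsMulCommutative F₂) :
    ∃ 𝒢 : Set (Subgroup (F₁ × F₂)),
      #𝒢 = 𝔠 ∧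
      (∀ G ∈ 𝒢, IsSubdirectProduct G) ∧
      𝒢.Pairwise fun G H => IsEmpty (integralH1 G ≃+ integralH1 H) := by
  obtain ⟨π₁, σ₁, hσ₁⟩ := IsFreeGroup.exists_retraction h₁
  obtain ⟨π₂, σ₂, hσ₂⟩ := IsFreeGroup.exists_retraction h₂
  let G (S : Set Nat.Primes) : Subgroup (F₁ × F₂) := fibreProduct π₁ π₂ (relatorSubgroup S)
  have mem_iff (S : Set Nat.Primes) (p : Nat.Primes) :
      (∃ x : integralH1 (G S), x ≠ 0 ∧ (p : ℕ) • x = 0) ↔ p ∈ S := by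
    rw [exists_torsion_integralH1_iff, exists_torsion_abelianization_fibreProduct_iff _ hσ₁ hσ₂ p
      (fun x => IsFreeGroup.mem_commutator_of_pow_mem p.2.ne_zero)
      (fun x => IsFreeGroup.mem_commutator_of_pow_mem p.2.ne_zero),
      exists_torsion_relatorSubgroup_iff]
  have hiso (S S' : Set Nat.Primes) (e : integralH1 (G S) ≃+ integralH1 (G S')) : S ⊆ S' := by
    intro p hp
    obtain ⟨x, hx, hpx⟩ := (mem_iff S p).2 hp
    exact (mem_iff S' p).1
      ⟨e x, fun h => hx (e.map_eq_zero_iff.1 h), by rw [← map_nsmul, hpx, map_zero]⟩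
  have hinj : Function.Injective G := fun S S' h => by
    ext p
    rw [← mem_iff S p, ← mem_iff S' p, h]
  refine ⟨Set.range G, ?_, ?_, ?_⟩
  · have := Cardinal.mk_range_eq_of_injective hinj
    rw [Cardinal.mk_set, Cardinal.mk_eq_aleph0 Nat.Primes, Cardinal.two_power_aleph0,
      Cardinal.lift_continuum] at this
    exact Cardinal.lift_injective (this.trans Cardinal.lift_continuum.symm)
  · rintro _ ⟨S, rfl⟩
    exact isSubdirectProduct_fibreProduct _ hσ₁ hσ₂
  · rintro _ ⟨S, rfl⟩ _ ⟨S', rfl⟩ hne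
    exact ⟨fun e => hne (congrArg G ((hiso S S' e).antisymm (hiso S' S e.symm)))⟩
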